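/- Let $G$ be a locally compact, separable, amenable topological group acting (jointly) continuously on a compact metric space $(X,\upsilon)$, and let $\mu$ be a Borel probability measure on $X$. Assume that - the action is uniquely ergodic for $\mu$, i.e. $\mu$ is the one and only $G$-invariant Borel probability measure on $X$; - the action is non-sensitive on $\operatorname{supp}\mu$, i.e. there is no $\beta>0$ such that for every $x\in\operatorname{supp}\mu$ and $\delta>0$ there exist $y\in X$ with $\upsilon(x,y)<\delta$ and $h\in G$ with $\upsilon(h(x),h(y))\ge\beta$. Let $\varphi_1,\varphi_2,\ldots$ be a sequence in $G$ that generates a dense subsemigroup of $G$. Let $M(X)$ be the set of Borel probability measures on $X$. For $g\in G$ let $\hat g:M(X)\to M(X)$ be the induced map, $(\hat g\sigma)(B)=\sigma(g^{-1}(B))$, and for a finite nonempty word $r=(r_1,\ldots,r_n)$ of positive integers put $\hat\varphi_r:=\hat\varphi_{r_n}\circ\cdots\circ\hat\varphi_{r_1}$. Let $\operatorname{conv}(\Phi)$ be the convex hull (with convex combinations of maps taken pointwise) of $\Phi:=\{\hat\varphi_r : r \text{ a finite nonempty word}\}$. Proposition 4.1. There is a sequence $(\rho_m)_{m\in\mathbb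 N}$ in $\operatorname{conv}(\Phi)$ such that, for every sequence $(f_n)_{n\ge1}$ dense in $C(X)$, with the corresponding metric $$d(\sigma,\nu)=\sum_{n=1}^\infty\frac{\left|\int f_n\,d\sigma-\int f_n\,d\nu\right|}{2^n\|f_n\|}$$ on $M(X)$ for the weak* topology (a term with $f_n=0$ is read as $0$), $$d(\rho_m(\sigma),\mu)\to0\quad\text{as } m\to\infty,\text{ uniformly over all }\sigma\in M(X).$$ -/

import Mathlib

open MeasureTheory Filter Topology
open scoped NNReal BoundedContinuousFunction

/-- Left translate of a bounded continuous function on a topological group: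
`leftTranslate g F` is the function `h ↦ F (g * h)`. -/
noncomputable def leftTranslate {G : Type*} [Group G] [TopologicalSpace G]
    [IsTopologicalGroup G] (g : G) (F : G →ᵇ ℝ) : G →ᵇ ℝ :=
  F.compContinuous ⟨fun h => g * h, continuous_const_mul g⟩

/-- Amenability of a (locally compact) topological group: there is a left-invariant mean, that is,
a normalized positive left-invariant linear functional, on the bounded continuous functions.
(For locally compact groups this is the same as a left-invariant mean on `L^∞` of Haar measure,
and such a mean restricts to one on the bounded continuous functions.) -/
def IsAmenableGroup (G : Type*) [Group G] [TopologicalSpace G] [IsTopologicalGroup G] : Prop :=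
  ∃ M : (G →ᵇ ℝ) →ₗ[ℝ] ℝ,
    M 1 = 1 ∧ (∀ F : G →ᵇ ℝ, (∀ h, 0 ≤ F h) → 0 ≤ M F) ∧
      ∀ (g : G) (F : G →ᵇ ℝ), M (leftTranslate g F) = M F

/-- The action of `G` on `X` is uniquely ergodic for `μ`: `μ` is the one and only `G`-invariant
Borel probability measure on `X`. -/
def IsUniquelyErgodicAction (G : Type*) {X : Type*} [SMul G X] [MeasurableSpace X]
    (μ : ProbabilityMeasure X) : Prop :=
  SMulInvariantMeasure G X (μ : Measure X) ∧
    ∀ ν : ProbabilityMeasure X, SMulInvariantMeasure G X (ν : Measure X) → ν = μ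

/-- The action of `G` on the metric space `X` is sensitive on the subset `S` of `X`. -/
def IsSensitiveOn (G : Type*) {X : Type*} [SMul G X] [MetricSpace X] (S : Set X) : Prop :=
  ∃ β : ℝ, 0 < β ∧ ∀ x ∈ S, ∀ δ : ℝ, 0 < δ →
    ∃ y : X, dist x y < δ ∧ ∃ h : G, β ≤ dist (h • x) (h • y)

section InducedMaps

variable {G X : Type*} [Group G] [TopologicalSpace G] [MetricSpace X] [MeasurableSpace X]
  [BorelSpace X] [MulAction G X] [ContinuousSMul G X]

/-- The map on Borel probability measures induced by `g : G`: `σ ↦ σ (g⁻¹ ·)`, the push-forward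
under `x ↦ g • x`. -/
noncomputable def inducedMap (g : G) (σ : ProbabilityMeasure X) : ProbabilityMeasure X :=
  σ.map (f := fun x : X => g • x) (continuous_const_smul g).measurable.aemeasurable

/-- For a finite word `r = [r₁, …, rₙ]`, the composition of the induced maps of
`φ r₁, …, φ rₙ`, in which the map of `φ r₁` is applied first and that of `φ rₙ` last. -/
noncomputable def wordInducedMap (φ : ℕ → G) (r : List ℕ) :
    ProbabilityMeasure X → ProbabilityMeasure X :=
  r.foldl (fun T i => inducedMap (φ i) ∘ T) id

/-- The set of all maps induced by nonempty finite words in the sequence `φ`. -/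
def wordMaps (X : Type*) [MetricSpace X] [MeasurableSpace X] [BorelSpace X] [MulAction G X]
    [ContinuousSMul G X] (φ : ℕ → G) : Set (ProbabilityMeasure X → ProbabilityMeasure X) :=
  {T | ∃ r : List ℕ, r ≠ [] ∧ T = wordInducedMap φ r}

end InducedMaps

/-- A self-map of the set of probability measures, regarded as a map into the `ℝ≥0`-module of all
measures, where convex combinations can be formed. -/
def toMeasureValued {X : Type*} [MeasurableSpace X]
    (T : ProbabilityMeasure X → ProbabilityMeasure X) : ProbabilityMeasure X → Measure X :=
  fun σ => (T σ : Measure X)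

/-- The convex hull of a set of self-maps of the set of probability measures; convex combinations
are taken pointwise, `(∑ cᵢ Tᵢ) σ = ∑ cᵢ (Tᵢ σ)`. -/
def convMaps {X : Type*} [MeasurableSpace X]
    (S : Set (ProbabilityMeasure X → ProbabilityMeasure X)) :
    Set (ProbabilityMeasure X → ProbabilityMeasure X) :=
  {T | toMeasureValued T ∈ convexHull ℝ≥0 (toMeasureValued '' S)}

/-- The weak* distance of two probability measures given by a sequence `f` (dense in `C(X, ℝ)`).
The sequence is indexed from `0`, so its `n`-th member has the weight `2 ^ (n + 1)`; a term with
`f n = 0` is `0`. -/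
noncomputable def weakStarDist {X : Type*} [MetricSpace X] [CompactSpace X] [MeasurableSpace X]
    (f : ℕ → C(X, ℝ)) (σ ν : ProbabilityMeasure X) : ℝ :=
  ∑' n : ℕ, |(∫ x, f n x ∂(σ : Measure X)) - ∫ x, f n x ∂(ν : Measure X)| /
    (2 ^ (n + 1) * ‖f n‖)

/-! ### Integration on a compact metric space. -/

section CompactMetric

variable {X : Type*} [MetricSpace X] [CompactSpace X] [MeasurableSpace X] [BorelSpace X]

/-! By duality it suffices to average functions: a convex combination of Koopman operators over the
dense subsemigroup `S` is dual to a map in the convex hull (`exists_convMaps_of_average`), and a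
sup-norm bound on the averaged function is a bound uniform in the measure. The core is
`exists_average_lt`. If no average of `f` lies below its mean plus `ε`, Hahn–Banach gives a positive
functional separating the averages from the functions below that constant. Density extends the
separation to the whole orbit of `f`; averaging over the amenable group makes the functional
invariant, hence by unique ergodicity a multiple of `μ`, which contradicts the separation. Averages
compose, preserve uniform bounds and fix `μ`-integrals, so the estimate becomes two-sided and then
holds for finitely many functions at once. The maps `ρ m` treat ever longer initial segments of a
dense sequence with error `1 / (m + 1)`. -/

theorem integrable_continuousMap (f : C(X, ℝ)) (ν : Measure X) [IsFiniteMeasure ν] :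
    Integrable (fun x => f x) ν :=
  f.continuous.integrable_of_hasCompactSupport (HasCompactSupport.of_compactSpace _)

/-- A positive linear functional on `C(X, ℝ)` is integration against a finite Borel measure. -/
theorem exists_finiteMeasure_of_positive (L : C(X, ℝ) →ₗ[ℝ] ℝ)
    (hL : ∀ f : C(X, ℝ), (∀ x, 0 ≤ f x) → 0 ≤ L f) :
    ∃ ν : Measure X, IsFiniteMeasure ν ∧ ∀ f : C(X, ℝ), ∫ x, f x ∂ν = L f := by
  let L₀ : CompactlySupportedContinuousMap X ℝ →ₗ[ℝ] ℝ :=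
    { toFun := fun f => L f.toContinuousMap
      map_add' := fun f g => L.map_add f.toContinuousMap g.toContinuousMap
      map_smul' := fun c f => L.map_smul c f.toContinuousMap }
  let L₁ := PositiveLinearMap.mk₀ L₀ fun f hf =>
    hL f.toContinuousMap (CompactlySupportedContinuousMap.le_def.1 hf)
  refine ⟨RealRMK.rieszMeasure L₁, inferInstance, fun f => ?_⟩
  exact RealRMK.integral_rieszMeasure L₁ (CompactlySupportedContinuousMap.continuousMapEquiv f)

end CompactMetric

/-! ### Words and the semigroup they generate. -/

section InducedMapWords

variable {G X : Type*} [Group G] [TopologicalSpace G]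
  [MetricSpace X] [MulAction G X] [ContinuousSMul G X]
  [MeasurableSpace X] [BorelSpace X]

theorem inducedMap_mul (g h : G) :
    (inducedMap (g * h) : ProbabilityMeasure X → _) = inducedMap g ∘ inducedMap h := by
  ext σ B hB
  have hm (a : G) : Measurable fun x : X => a • x := (continuous_const_smul a).measurable
  simp only [inducedMap, Function.comp_apply, ProbabilityMeasure.toMeasure_map]
  rw [Measure.map_map (hm g) (hm h)]
  congr 2
  funext x
  exact mul_smul g h x

theorem wordInducedMap_append (φ : ℕ → G) (r s : List ℕ) :
    (wordInducedMap φ (r ++ s) : ProbabilityMeasure X → _) =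
      wordInducedMap φ s ∘ wordInducedMap φ r := by
  induction s using List.reverseRecOn with
  | nil => simp [wordInducedMap]
  | append_singleton s i ih =>
    have key (t : List ℕ) : (wordInducedMap φ (t ++ [i]) : ProbabilityMeasure X → _) =
        inducedMap (φ i) ∘ wordInducedMap φ t := by
      simp [wordInducedMap]
    rw [← List.append_assoc, key, key, ih, Function.comp_assoc]

theorem inducedMap_mem_wordMaps (φ : ℕ → G) {s : G}
    (hs : s ∈ Subsemigroup.closure (Set.range φ)) : inducedMap s ∈ wordMaps X φ := by
  induction hs using Subsemigroup.closure_induction with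
  | mem x hx =>
    obtain ⟨i, rfl⟩ := hx
    exact ⟨[i], by simp, by simp [wordInducedMap]⟩
  | mul x y _ _ hx hy =>
    obtain ⟨r, hr, h⟩ := hx
    obtain ⟨t, ht, h'⟩ := hy
    -- The right factor of a product acts first, so its word comes first.
    exact ⟨t ++ r, by simp [hr], by rw [wordInducedMap_append, inducedMap_mul, h, h']⟩

end InducedMapWords

/-! ### Koopman operators and their averages. -/

section Koopman

variable {G X : Type*} [Group G] [TopologicalSpace G]
  [MetricSpace X] [MulAction G X] [ContinuousSMul G X]

/-- The action of a group element, as a continuous self-map of the space. -/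
def smulMap (X : Type*) [MetricSpace X] [MulAction G X] [ContinuousSMul G X] (g : G) : C(X, X) :=
  ⟨fun x => g • x, continuous_const_smul g⟩

/-- The Koopman operator `f ↦ f ∘ g` on continuous functions. -/
def koopman (X : Type*) [MetricSpace X] [MulAction G X] [ContinuousSMul G X] (g : G) :
    C(X, ℝ) →ₗ[ℝ] C(X, ℝ) where
  toFun f := f.comp (smulMap X g)
  map_add' _ _ := rfl
  map_smul' _ _ := rfl

@[simp]
theorem koopman_apply (g : G) (f : C(X, ℝ)) (x : X) : koopman X g f x = f (g • x) := rfl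

theorem koopman_comp_koopman (g h : G) : koopman X g ∘ₗ koopman X h = koopman X (h * g) := by
  ext f x
  simp [mul_smul]

theorem continuous_koopman (f : C(X, ℝ)) : Continuous fun g : G => koopman X g f := by
  refine ContinuousMap.continuous_of_continuous_uncurry _ ?_
  exact f.continuous.comp continuous_smul

/-- The averaging operators: convex combinations of Koopman operators of members of `S`. -/
def koopmanAverages (X : Type*) [MetricSpace X] [MulAction G X] [ContinuousSMul G X]
    (S : Subsemigroup G) : Set (C(X, ℝ) →ₗ[ℝ] C(X, ℝ)) :=
  convexHull ℝ (koopman X '' (S : Set G))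

theorem koopman_mem_averages {S : Subsemigroup G} {s : G} (hs : s ∈ S) :
    koopman X s ∈ koopmanAverages X S :=
  subset_convexHull ℝ _ ⟨s, hs, rfl⟩

/-- Composition is linear in each factor, so the hull of a semigroup of operators is again a
semigroup. -/
theorem comp_mem_averages {S : Subsemigroup G} {A B : C(X, ℝ) →ₗ[ℝ] C(X, ℝ)}
    (hA : A ∈ koopmanAverages X S) (hB : B ∈ koopmanAverages X S) :
    A ∘ₗ B ∈ koopmanAverages X S := by
  have hconv : Convex ℝ (koopmanAverages X S) := convex_convexHull ℝ _
  have key : ∀ s ∈ S, koopmanAverages X S ⊆ {B | koopman X s ∘ₗ B ∈ koopmanAverages X S} := by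
    intro s hs
    refine convexHull_min ?_ ?_
    · rintro _ ⟨t, ht, rfl⟩
      simp only [Set.mem_ofPred_eq, koopman_comp_koopman]
      exact koopman_mem_averages (S.mul_mem ht hs)
    · intro B₁ h₁ B₂ h₂ a b ha hb hab
      simp only [Set.mem_ofPred_eq, LinearMap.comp_add, LinearMap.comp_smul] at *
      exact hconv h₁ h₂ ha hb hab
  have : koopmanAverages X S ⊆ {A | A ∘ₗ B ∈ koopmanAverages X S} := by
    refine convexHull_min ?_ ?_
    · rintro _ ⟨s, hs, rfl⟩
      exact key s hs hB
    · intro A₁ h₁ A₂ h₂ a b ha hb hab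
      simp only [Set.mem_ofPred_eq, LinearMap.add_comp, LinearMap.smul_comp] at *
      exact hconv h₁ h₂ ha hb hab
  exact this hA

theorem average_le {S : Subsemigroup G} {A : C(X, ℝ) →ₗ[ℝ] C(X, ℝ)}
    (hA : A ∈ koopmanAverages X S) {f : C(X, ℝ)} {c : ℝ} (hf : ∀ x, f x ≤ c) (x : X) :
    A f x ≤ c := by
  have : koopmanAverages X S ⊆ {A | A f x ≤ c} := by
    refine convexHull_min ?_ ?_
    · rintro _ ⟨s, -, rfl⟩
      exact hf _
    · intro A₁ h₁ A₂ h₂ a b ha hb hab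
      simp only [Set.mem_ofPred_eq] at h₁ h₂
      simp only [Set.mem_ofPred_eq, LinearMap.add_apply, LinearMap.smul_apply,
        ContinuousMap.add_apply, ContinuousMap.smul_apply, smul_eq_mul]
      calc a * A₁ f x + b * A₂ f x ≤ a * c + b * c := by gcongr
        _ = c := by rw [← add_mul, hab, one_mul]
  exact this hA

theorem abs_average_sub_le {S : Subsemigroup G} {A : C(X, ℝ) →ₗ[ℝ] C(X, ℝ)}
    (hA : A ∈ koopmanAverages X S) {f : C(X, ℝ)} {c ε : ℝ} (hf : ∀ x, |f x - c| ≤ ε) (x : X) :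
    |A f x - c| ≤ ε := by
  have h₁ := average_le hA (f := f) (c := c + ε) (fun y => by linarith [(abs_le.1 (hf y)).2]) x
  have h₂ := average_le hA (f := -f) (c := ε - c)
    (fun y => by simpa using by linarith [(abs_le.1 (hf y)).1]) x
  simp only [map_neg, ContinuousMap.neg_apply] at h₂
  exact abs_le.2 ⟨by linarith, by linarith⟩

variable [CompactSpace X]

theorem bounded_orbit (ℓ : C(X, ℝ) →L[ℝ] ℝ) (f : C(X, ℝ)) (g : G) :
    ‖ℓ (koopman X g f)‖ ≤ ‖ℓ‖ * ‖f‖ := by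
  refine (ℓ.le_opNorm _).trans ?_
  gcongr
  exact (ContinuousMap.norm_le _ (norm_nonneg _)).2 fun x => f.norm_coe_le_norm _

/-- The function `g ↦ ℓ (f ∘ g)` on the group. -/
noncomputable def orbitFunction (ℓ : C(X, ℝ) →L[ℝ] ℝ) : C(X, ℝ) →ₗ[ℝ] (G →ᵇ ℝ) where
  toFun f := BoundedContinuousFunction.ofNormedAddCommGroup (fun g : G => ℓ (koopman X g f))
    (ℓ.continuous.comp (continuous_koopman f)) _ (bounded_orbit ℓ f)
  map_add' f₁ f₂ := by ext g; simp
  map_smul' c f := by ext g; simp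

@[simp]
theorem orbitFunction_apply (ℓ : C(X, ℝ) →L[ℝ] ℝ) (f : C(X, ℝ)) (g : G) :
    orbitFunction ℓ f g = ℓ (koopman X g f) := rfl

variable [MeasurableSpace X] [BorelSpace X]

theorem integral_average (μ : Measure X) [IsFiniteMeasure μ] [SMulInvariantMeasure G X μ]
    {S : Subsemigroup G} {A : C(X, ℝ) →ₗ[ℝ] C(X, ℝ)}
    (hA : A ∈ koopmanAverages X S) (f : C(X, ℝ)) :
    ∫ x, A f x ∂μ = ∫ x, f x ∂μ := by
  have : koopmanAverages X S ⊆ {A | ∫ x, A f x ∂μ = ∫ x, f x ∂μ} := by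
    refine convexHull_min ?_ ?_
    · rintro _ ⟨s, -, rfl⟩
      have hm : Measurable fun x : X => s • x := (continuous_const_smul s).measurable
      have hmap : μ.map (fun x => s • x) = μ := by
        ext B hB
        rw [Measure.map_apply hm hB]
        exact SMulInvariantMeasure.measure_preimage_smul s hB
      have := integral_map (μ := μ) hm.aemeasurable f.continuous.aestronglyMeasurable
      rw [hmap] at this
      exact this.symm
    · intro A₁ h₁ A₂ h₂ a b ha hb hab
      simp only [Set.mem_ofPred_eq] at h₁ h₂
      simp only [Set.mem_ofPred_eq, LinearMap.add_apply, LinearMap.smul_apply,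
        ContinuousMap.add_apply, ContinuousMap.smul_apply, smul_eq_mul]
      rw [integral_add ((integrable_continuousMap _ μ).const_mul _)
        ((integrable_continuousMap _ μ).const_mul _), integral_const_mul, integral_const_mul,
        h₁, h₂, ← add_mul, hab, one_mul]
  exact this hA

/-- The Riesz measure of `L` is invariant; unless it vanishes, its normalization is an invariant
probability measure, hence `μ`. -/
theorem eq_integral_of_invariant {μ : ProbabilityMeasure X} (hμ : IsUniquelyErgodicAction G μ)
    (L : C(X, ℝ) →ₗ[ℝ] ℝ) (hL : ∀ f : C(X, ℝ), (∀ x, 0 ≤ f x) → 0 ≤ L f)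
    (hinv : ∀ (g : G) (f : C(X, ℝ)), L (koopman X g f) = L f) (f : C(X, ℝ)) :
    L f = L 1 * ∫ x, f x ∂(μ : Measure X) := by
  obtain ⟨ν, hν, hνL⟩ := exists_finiteMeasure_of_positive L hL
  have hmass : ν.real Set.univ = L 1 := by simp [← hνL]
  by_cases h0 : ν = 0
  · subst h0
    rw [← hνL, ← hνL]
    simp
  have hmap : ∀ g : G, ν.map (fun x => g • x) = ν := by
    intro g
    have hm : Measurable fun x : X => g • x := (continuous_const_smul g).measurable
    have : IsFiniteMeasure (ν.map fun x => g • x) := inferInstance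
    refine ext_of_forall_integral_eq_of_IsFiniteMeasure fun F => ?_
    rw [integral_map hm.aemeasurable F.continuous.aestronglyMeasurable]
    have h := hinv g F.toContinuousMap
    rw [← hνL, ← hνL] at h
    exact h
  have : NeZero ν := ⟨h0⟩
  let ν' : ProbabilityMeasure X := ⟨(ν Set.univ)⁻¹ • ν, inferInstance⟩
  have hν' : ν' = μ := by
    refine hμ.2 ν' ⟨fun g B hB => ?_⟩
    have hm : Measurable fun x : X => g • x := (continuous_const_smul g).measurable
    have : ν ((fun x => g • x) ⁻¹' B) = ν B := by
      rw [← Measure.map_apply hm hB, hmap]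
    simp [ν', this]
  rw [← hν', ← hνL, ← hmass]
  have hne : ν.real Set.univ ≠ 0 := (measureReal_ne_zero_iff (measure_ne_top ν _)).2 (by simp [h0])
  have hcoe : (ν' : Measure X) = (ν Set.univ)⁻¹ • ν := rfl
  rw [hcoe, integral_smul_measure, ENNReal.toReal_inv, smul_eq_mul, ← mul_assoc]
  rw [← measureReal_def, mul_inv_cancel₀ hne, one_mul]

theorem exists_convMaps_of_average (φ : ℕ → G) {A : C(X, ℝ) →ₗ[ℝ] C(X, ℝ)}
    (hA : A ∈ koopmanAverages X (Subsemigroup.closure (Set.range φ))) :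
    ∃ ρ ∈ convMaps (wordMaps X φ), ∀ (f : C(X, ℝ)) (σ : ProbabilityMeasure X),
      ∫ x, f x ∂(ρ σ : Measure X) = ∫ x, A f x ∂(σ : Measure X) := by
  have : koopmanAverages X (Subsemigroup.closure (Set.range φ)) ⊆
      {A | ∃ ρ ∈ convMaps (wordMaps X φ), ∀ (f : C(X, ℝ)) (σ : ProbabilityMeasure X),
        ∫ x, f x ∂(ρ σ : Measure X) = ∫ x, A f x ∂(σ : Measure X)} := by
    refine convexHull_min ?_ ?_
    · rintro _ ⟨s, hs, rfl⟩
      refine ⟨inducedMap s, subset_convexHull _ _ ⟨_, inducedMap_mem_wordMaps φ hs, rfl⟩,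
        fun f σ => ?_⟩
      rw [inducedMap, ProbabilityMeasure.toMeasure_map,
        integral_map (continuous_const_smul s).measurable.aemeasurable
          f.continuous.aestronglyMeasurable]
      rfl
    · rintro A₁ ⟨ρ₁, hρ₁, h₁⟩ A₂ ⟨ρ₂, hρ₂, h₂⟩ a b ha hb hab
      lift a to ℝ≥0 using ha
      lift b to ℝ≥0 using hb
      have hab' : a + b = 1 := by exact_mod_cast hab
      have hprob (σ : ProbabilityMeasure X) :
          IsProbabilityMeasure (a • (ρ₁ σ : Measure X) + b • (ρ₂ σ : Measure X)) := by
        refine ⟨?_⟩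
        simp only [Measure.coe_add, Measure.coe_nnreal_smul_apply, Pi.add_apply, measure_univ,
          mul_one]
        exact_mod_cast hab'
      refine ⟨fun σ => ⟨a • (ρ₁ σ : Measure X) + b • (ρ₂ σ : Measure X), hprob σ⟩, ?_, ?_⟩
      · exact (convex_convexHull ℝ≥0 _) hρ₁ hρ₂ zero_le zero_le hab'
      · intro f σ
        simp only [ProbabilityMeasure.coe_mk, LinearMap.add_apply, LinearMap.smul_apply,
          ContinuousMap.add_apply, ContinuousMap.smul_apply, smul_eq_mul]
        rw [integral_add_measure (integrable_continuousMap f _) (integrable_continuousMap f _),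
          integral_smul_nnreal_measure, integral_smul_nnreal_measure, h₁, h₂,
          integral_add ((integrable_continuousMap _ _).const_mul _)
          ((integrable_continuousMap _ _).const_mul _), integral_const_mul, integral_const_mul]
        rfl
  exact this hA

/-! ### Averages uniformly close to the space mean. -/

variable [IsTopologicalGroup G]

/-- Some average of `f` exceeds the space mean by less than `ε` everywhere: otherwise a positive
functional separates the averages from the functions below that bound, and its mean over the group
contradicts unique ergodicity. -/
theorem exists_average_lt (hG : IsAmenableGroup G) {μ : ProbabilityMeasure X}
    (hμ : IsUniquelyErgodicAction G μ) {S : Subsemigroup G} (hS : Dense (S : Set G))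
    (f : C(X, ℝ)) {ε : ℝ} (hε : 0 < ε) :
    ∃ A ∈ koopmanAverages X S, ∀ x, A f x < (∫ x, f x ∂(μ : Measure X)) + ε := by
  by_contra! hcon
  obtain ⟨M, hM1, hMpos, hMinv⟩ := hG
  set c := (∫ x, f x ∂(μ : Measure X)) + ε with hc
  let U : Set C(X, ℝ) := {h | ∀ x, h x < c}
  have hUconv : Convex ℝ U := by
    intro h₁ H₁ h₂ H₂ a b ha hb hab x
    exact (convex_Iio c) (H₁ x) (H₂ x) ha hb hab
  have hUopen : IsOpen U := by
    have := ContinuousMap.isOpen_setOfPred_mapsTo (X := X) (Y := ℝ) isCompact_univ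
      (isOpen_Iio (a := c))
    simpa [U, Set.MapsTo] using this
  let T : Set C(X, ℝ) := (LinearMap.applyₗ f : _ →ₗ[ℝ] C(X, ℝ)) '' koopmanAverages X S
  have hT : Convex ℝ T := (convex_convexHull ℝ _).linear_image _
  have hdisj : Disjoint U T := by
    rw [Set.disjoint_left]
    rintro _ hU ⟨A, hA, rfl⟩
    obtain ⟨x, hx⟩ := hcon A hA
    exact absurd (hU x) (not_lt.2 hx)
  obtain ⟨ℓ, u, hℓU, hℓT⟩ := geometric_hahn_banach_open hUconv hUopen hT hdisj
  have hℓpos : ∀ h : C(X, ℝ), (∀ x, 0 ≤ h x) → 0 ≤ ℓ h := by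
    intro h hh
    by_contra! hneg
    obtain ⟨n, hn⟩ := exists_nat_gt ((u - ℓ ((c - 1) • 1)) / (-ℓ h))
    rw [div_lt_iff₀ (by linarith)] at hn
    -- Subtracting multiples of `h ≥ 0` stays in `U`, where `ℓ` is bounded by `u`; if `ℓ h < 0`, a
    -- large multiple breaks this bound.
    have hmem : (c - 1) • (1 : C(X, ℝ)) - (n : ℝ) • h ∈ U := by
      intro x
      have : 0 ≤ (n : ℝ) * h x := mul_nonneg n.cast_nonneg (hh x)
      simp only [ContinuousMap.sub_apply, ContinuousMap.smul_apply, ContinuousMap.one_apply,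
        smul_eq_mul]
      linarith
    have := hℓU _ hmem
    rw [map_sub, map_smul ℓ (n : ℝ) h, smul_eq_mul] at this
    linarith
  have hk : 0 ≤ ℓ 1 := hℓpos 1 fun x => zero_le_one
  have hlt : ∀ t < c, t * ℓ 1 < u := by
    intro t ht
    have := hℓU (t • 1) (fun x => by simpa using ht)
    rwa [map_smul, smul_eq_mul] at this
  -- The bound holds on `S` and is closed in `g`, as the orbit map is norm continuous.
  have hge : ∀ g : G, u ≤ ℓ (koopman X g f) := by
    have hclosed : IsClosed {g : G | u ≤ ℓ (koopman X g f)} :=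
      isClosed_le continuous_const (ℓ.continuous.comp (continuous_koopman f))
    intro g
    exact hclosed.closure_subset_iff.2
      (fun s hs => hℓT _ ⟨_, koopman_mem_averages hs, rfl⟩) (hS g)
  let L : C(X, ℝ) →ₗ[ℝ] ℝ := M ∘ₗ orbitFunction (G := G) ℓ
  have hL : ∀ h : C(X, ℝ), (∀ x, 0 ≤ h x) → 0 ≤ L h := fun h hh =>
    hMpos _ fun g => hℓpos _ fun x => hh _
  have hLinv : ∀ (g : G) (h : C(X, ℝ)), L (koopman X g h) = L h := by
    intro g h
    have : orbitFunction ℓ (koopman X g h) = leftTranslate g (orbitFunction ℓ h) := by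
      ext a
      change ℓ ((koopman X a ∘ₗ koopman X g) h) = ℓ (koopman X (g * a) h)
      rw [koopman_comp_koopman]
    change M _ = M _
    rw [this, hMinv]
  have hL1 : L 1 = ℓ 1 := by
    have : orbitFunction (G := G) ℓ 1 = ℓ 1 • 1 := by
      ext a
      have : koopman X a 1 = 1 := rfl
      simp [this]
    change M _ = _
    rw [this, map_smul, hM1, smul_eq_mul, mul_one]
  have hLf : u ≤ L f := by
    have h := hMpos (orbitFunction ℓ f - u • 1) fun g => by simpa using hge g
    rw [map_sub, map_smul, hM1, smul_eq_mul, mul_one] at h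
    exact sub_nonneg.1 h
  rw [eq_integral_of_invariant hμ L hL hLinv f, hL1] at hLf
  -- Here `c - ε` is the mean of `f`: the constant function with this value lies in `U`, against
  -- `hLf`.
  have := hlt (c - ε) (by linarith)
  rw [hc, add_sub_cancel_right] at this
  linarith [mul_comm (ℓ 1) (∫ x, f x ∂(μ : Measure X))]

/-- The second average, chosen for `-A f`, gives the lower bound and keeps the upper bound already
achieved by `A`. -/
theorem exists_average_close (hG : IsAmenableGroup G) {μ : ProbabilityMeasure X}
    (hμ : IsUniquelyErgodicAction G μ) {S : Subsemigroup G} (hS : Dense (S : Set G))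
    (f : C(X, ℝ)) {ε : ℝ} (hε : 0 < ε) :
    ∃ A ∈ koopmanAverages X S, ∀ x, |A f x - ∫ x, f x ∂(μ : Measure X)| ≤ ε := by
  have := hμ.1
  obtain ⟨A, hA, hAf⟩ := exists_average_lt hG hμ hS f hε
  obtain ⟨B, hB, hBf⟩ := exists_average_lt hG hμ hS (-A f) hε
  refine ⟨B ∘ₗ A, comp_mem_averages hB hA, fun x => ?_⟩
  have h₁ := average_le hB (fun y => (hAf y).le) x
  have h₂ := hBf x
  simp only [map_neg, ContinuousMap.neg_apply, integral_neg,
    integral_average (μ : Measure X) hA f] at h₂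
  simp only [LinearMap.comp_apply]
  exact abs_le.2 ⟨by linarith, by linarith⟩

theorem exists_average_forall_close (hG : IsAmenableGroup G) {μ : ProbabilityMeasure X}
    (hμ : IsUniquelyErgodicAction G μ) {S : Subsemigroup G} (hS : Dense (S : Set G))
    (f : ℕ → C(X, ℝ)) {ε : ℝ} (hε : 0 < ε) (n : ℕ) :
    ∃ A ∈ koopmanAverages X S, ∀ k ≤ n, ∀ x, |A (f k) x - ∫ x, f k x ∂(μ : Measure X)| ≤ ε := by
  have := hμ.1
  induction n with
  | zero =>
    obtain ⟨A, hA, h⟩ := exists_average_close hG hμ hS (f 0) hε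
    exact ⟨A, hA, fun k hk => by rwa [Nat.le_zero.1 hk]⟩
  | succ n ih =>
    obtain ⟨A, hA, h⟩ := ih
    obtain ⟨B, hB, h'⟩ := exists_average_close hG hμ hS (A (f (n + 1))) hε
    refine ⟨B ∘ₗ A, comp_mem_averages hB hA, fun k hk x => ?_⟩
    rcases Nat.le_succ_iff.1 hk with hk | rfl
    · exact abs_average_sub_le hB (h k hk) x
    · rw [integral_average (μ : Measure X) hA] at h'
      exact h' x

end Koopman

/-! ### From integrals to the weak* distance. -/

section WeakStar

variable {X : Type*} [MetricSpace X] [CompactSpace X] [MeasurableSpace X] [BorelSpace X]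

theorem abs_integral_sub_le (f h : C(X, ℝ)) (σ : ProbabilityMeasure X) :
    |(∫ x, f x ∂(σ : Measure X)) - ∫ x, h x ∂(σ : Measure X)| ≤ ‖f - h‖ := by
  rw [← integral_sub (integrable_continuousMap f _) (integrable_continuousMap h _)]
  simpa using norm_integral_le_of_norm_le_const (μ := (σ : Measure X)) (C := ‖f - h‖)
    (f := fun x => f x - h x) (ae_of_all _ fun x => (f - h).norm_coe_le_norm x)

/-- Uniform convergence of integrals passes from a dense sequence to all continuous functions. -/
theorem tendsto_integral_sub_of_denseRange {ι : Type*} {l : Filter ι}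
    {ρ : ι → ProbabilityMeasure X} {μ : ProbabilityMeasure X} {g : ℕ → C(X, ℝ)}
    (hg : DenseRange g)
    (h : ∀ k, Tendsto (fun i => (∫ x, g k x ∂(ρ i : Measure X)) - ∫ x, g k x ∂(μ : Measure X))
      l (𝓝 0)) (f : C(X, ℝ)) :
    Tendsto (fun i => (∫ x, f x ∂(ρ i : Measure X)) - ∫ x, f x ∂(μ : Measure X)) l (𝓝 0) := by
  rw [Metric.tendsto_nhds]
  intro ε hε
  obtain ⟨k, hk⟩ := hg.exists_dist_lt f (show 0 < ε / 3 by positivity)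
  rw [dist_eq_norm] at hk
  filter_upwards [Metric.tendsto_nhds.1 (h k) (ε / 3) (by positivity)] with i hi
  rw [Real.dist_0_eq_abs] at hi ⊢
  have h₁ := abs_le.1 (abs_integral_sub_le f (g k) (ρ i))
  have h₂ := abs_le.1 (abs_integral_sub_le f (g k) μ)
  have h₃ := abs_lt.1 hi
  exact abs_lt.2 ⟨by linarith [h₁.1, h₂.2, h₃.1], by linarith [h₁.2, h₂.1, h₃.2]⟩

theorem tendsto_weakStarDist {ι : Type*} {l : Filter ι}
    {ρ : ι → ProbabilityMeasure X} {μ : ProbabilityMeasure X}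
    (h : ∀ f : C(X, ℝ),
      Tendsto (fun i => (∫ x, f x ∂(ρ i : Measure X)) - ∫ x, f x ∂(μ : Measure X)) l (𝓝 0))
    (f : ℕ → C(X, ℝ)) :
    Tendsto (fun i => weakStarDist f (ρ i) μ) l (𝓝 0) := by
  have hlim : Tendsto (fun i => weakStarDist f (ρ i) μ) l (𝓝 (∑' _ : ℕ, (0 : ℝ))) := by
    -- Each integral is at most `‖f n‖` in absolute value, so the term is at most `2 / 2 ^ (n + 1)`;
    -- for `f n = 0` it is `0 / 0 = 0`.
    refine tendsto_tsum_of_dominated_convergence (bound := fun n : ℕ => (1 / 2 : ℝ) ^ n)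
      summable_geometric_two (fun n => ?_) (Eventually.of_forall fun i n => ?_)
    · simpa using (h (f n)).abs.div_const (2 ^ (n + 1) * ‖f n‖)
    · have h₁ := abs_integral_sub_le (f n) 0 (ρ i)
      have h₂ := abs_integral_sub_le (f n) 0 μ
      simp only [ContinuousMap.zero_apply, integral_zero, sub_zero] at h₁ h₂
      rw [Real.norm_of_nonneg (by positivity)]
      refine div_le_of_le_mul₀ (by positivity) (by positivity) ?_
      calc _ ≤ ‖f n‖ + ‖f n‖ := (abs_sub _ _).trans (add_le_add h₁ h₂)
        _ = (1 / 2 : ℝ) ^ n * (2 ^ (n + 1) * ‖f n‖) := by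
          rw [pow_succ, ← mul_assoc, ← mul_assoc, ← mul_pow]
          norm_num
          ring
  simpa using hlim

end WeakStar

theorem proposition4p1 {G X : Type*}
    [Group G] [TopologicalSpace G] [IsTopologicalGroup G] [LocallyCompactSpace G]
    [TopologicalSpace.SeparableSpace G]
    [MetricSpace X] [CompactSpace X] [MeasurableSpace X] [BorelSpace X]
    [MulAction G X] [ContinuousSMul G X]
    (hG : IsAmenableGroup G)
    (μ : ProbabilityMeasure X)
    (hμ : IsUniquelyErgodicAction G μ)
    (hsens : ¬ IsSensitiveOn G (μ : Measure X).support)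
    (φ : ℕ → G)
    (hφ : Dense (Subsemigroup.closure (Set.range φ) : Set G)) :
    ∃ ρ : ℕ → ProbabilityMeasure X → ProbabilityMeasure X,
      (∀ m, ρ m ∈ convMaps (wordMaps X φ)) ∧
      ∀ f : ℕ → C(X, ℝ), DenseRange f →
        TendstoUniformly (fun (m : ℕ) (σ : ProbabilityMeasure X) => weakStarDist f (ρ m σ) μ)
          (fun _ => 0) atTop := by
  obtain ⟨g, hg⟩ := TopologicalSpace.exists_dense_seq C(X, ℝ)
  have hex : ∀ m : ℕ, ∃ ρ ∈ convMaps (wordMaps X φ), ∀ k ≤ m, ∀ σ : ProbabilityMeasure X,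
      |(∫ x, g k x ∂(ρ σ : Measure X)) - ∫ x, g k x ∂(μ : Measure X)| ≤ 1 / ((m : ℝ) + 1) := by
    intro m
    obtain ⟨A, hA, h⟩ := exists_average_forall_close hG hμ hφ g
      (show 0 < 1 / ((m : ℝ) + 1) by positivity) m
    obtain ⟨ρ, hρ, hρA⟩ := exists_convMaps_of_average φ hA
    refine ⟨ρ, hρ, fun k hk σ => ?_⟩
    have hb := norm_integral_le_of_norm_le_const (μ := (σ : Measure X))
      (f := fun x => A (g k) x - ∫ x, g k x ∂(μ : Measure X)) (ae_of_all _ (h k hk))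
    rw [integral_sub (integrable_continuousMap _ _) (integrable_const _)] at hb
    simpa [hρA] using hb
  choose ρ hρ hclose using hex
  refine ⟨ρ, hρ, fun f _ => ?_⟩
  rw [tendstoUniformly_iff_tendsto]
  -- Uniformity in `σ` is convergence of the pair `(m, σ)` along `atTop ×ˢ ⊤`, so the limit lemmas
  -- for a general filter apply.
  have hlim : Tendsto (fun q : ℕ × ProbabilityMeasure X => weakStarDist f (ρ q.1 q.2) μ)
      (atTop ×ˢ ⊤) (𝓝 0) := by
    refine tendsto_weakStarDist (tendsto_integral_sub_of_denseRange hg fun k => ?_) f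
    refine squeeze_zero_norm' (a := fun q : ℕ × ProbabilityMeasure X => 1 / ((q.1 : ℝ) + 1)) ?_
      (tendsto_one_div_add_atTop_nhds_zero_nat.comp tendsto_fst)
    filter_upwards [tendsto_fst.eventually (eventually_ge_atTop k)] with q hq
    exact hclose q.1 k hq q.2
  rw [nhds_eq_comap_uniformity, tendsto_comap_iff] at hlim
  exact hlim
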